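/- Let $\Lambda,\Omega$ be countably infinite sets, and let $\mathcal F$ be a nonempty family of infinite subsets of $\Omega$ such that $F\setminus K\in\mathcal F$ for every $F\in\mathcal F$ and every finite $K\subseteq\Omega$. A function $\rho$ from $\mathcal F$ to the infinite subsets of $\Lambda$ is *partition regular* if - (M) $E\subseteq F$ implies $\rho(E)\subseteq\rho(F)$ for all $E,F\in\mathcal F$; - (R) if $F\in\mathcal F$ and $\rho(F)=A\cup B$, then there is $E\in\mathcal F$ with $\rho(E)\subseteq A$ or $\rho(E)\subseteq B$; - (S) for every $F\in\mathcal F$ there is $E\in\mathcal F$ with $E\subseteq F$ such that for every $a\in\rho(E)$ there is a finite $K\subseteq\Omega$ with $a\notin\rho(E\setminus K)$. Let $\mathcal I_\rho=\{A\subseteq\Lambda:\rho(F)\not\subseteq A\text{ for all }F\in\mathcal F\}$ and $\mathcal I_\rho^+=\mathcal P(\Lambda)\setminus\mathcal I_\rho$. Write $\rho(F)\subseteq^\rho B$ if $\rho(F\setminus K)\subseteq B$ for some finite $K\subseteq\Omega$. The function $\rho$ is - *tall* if every infinite $A\subseteq\Lambda$ contains an infinite $B\in\mathcal I_\rho$;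 - $P^+$ if for every $\subseteq$-decreasing sequence $(A_n)_{n\in\omega}$ in $\mathcal I_\rho^+$ there is $F\in\mathcal F$ with $\rho(F)\subseteq^\rho A_n$ for all $n$; - $P^-$ if this holds for all such sequences with $A_n\setminus A_{n+1}\in\mathcal I_\rho$ for all $n$; - $P^-(\Lambda)$ if this holds for all such sequences with $A_n\setminus A_{n+1}\in\mathcal I_\rho$ for all $n$ and $A_0=\Lambda$; - *weak* $P^+$ if for every $E\in\mathcal F$ there is $F\in\mathcal F$ with $\rho(F)\subseteq\rho(E)$ such that for every sequence $(F_n)_{n\in\omega}$ in $\mathcal F$ with $\rho(F)\supseteq\rho(F_n)\supseteq\rho(F_{n+1})$ for all $n$ there is $G\in\mathcal F$ with $\rho(G)\subseteq^\rho\rho(F_n)$ for all $n$. For a topological space $X$, a function $f:\rho(F)\to X$ (with $F\in\mathcal F$) is *$\rho$-convergent* to $x\in X$ if for every neighbourhood $U$ of $x$ there is a finite $K\subseteq\Omega$ with $f[\rho(F\setminus K)]\subseteq U$. $\mathrm{FinBW}(\rho)$ is the class of all spaces $X$ such that for every $f:\Lambda\to X$ there is $F\in\mathcal F$ with $f\restriction\rho(F)$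 $\rho$-convergent to some point of $X$. $\mathrm{hFinBW}(\rho)$ is the class of all spaces $X$ such that for every $E\in\mathcal F$ and $f:\rho(E)\to X$ there is $F\in\mathcal F$ with $\rho(F)\subseteq\rho(E)$ and $f\restriction\rho(F)$ $\rho$-convergent to some point of $X$. **Theorem.** Let $\rho$ be partition regular. 1. $\mathrm{FinBW}(\rho)$ contains all finite spaces, and every space in $\mathrm{FinBW}(\rho)$ is sequentially compact. 2. $\rho$ is not tall if and only if $\mathrm{FinBW}(\rho)$ coincides with the class of all sequentially compact spaces. (This holds both for the classes of all topological spaces and for the classes of Hausdorff spaces.) 3. The following are equivalent: (a) $\rho$ is $P^-(\Lambda)$; (b) for every cardinal $\kappa$ there is a compact Hausdorff space of cardinality $\kappa$ in $\mathrm{FinBW}(\rho)$; (c) there is an infinite Hausdorff space in $\mathrm{FinBW}(\rho)$. 4. The following are equivalent: (a) $\rho$ is $P^-$; (b) for every cardinal $\kappa$ there is a compact Hausdorff space of cardinality $\kappa$ in $\mathrm{hFinBW}(\rho)$; (c) there is an infinite Hausdorff space in $\mathrm{hFinBW}(\rho)$. 5. If $\rho$ is $P^-$, then (a) the uncountable,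 non-compact Hausdorff space $\omega_1$ with the order topology belongs to $\mathrm{FinBW}(\rho)$; (b) assuming the Continuum Hypothesis, there is a compact separable Hausdorff space of cardinality $\mathfrak c$ in $\mathrm{FinBW}(\rho)$. 6. If $\rho$ is weak $P^+$, then every compact metric space belongs to $\mathrm{hFinBW}(\rho)$. 7. If $\rho$ is $P^+$, then every Hausdorff space $X$ such that the closure of every countable $D\subseteq X$ is compact and first-countable belongs to $\mathrm{hFinBW}(\rho)$. -/

import Mathlib

open Set Topology

universe u v w

/-- A partition regular function `ρ : 𝓕 → [Λ]^ω`, where `𝓕` is a nonempty family of infinite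
subsets of `Ω` that is closed under removing finite sets. The function is represented by a total
function `Set Ω → Set Λ`; only its values on members of `𝓕` are constrained, and only these values
are used in the notions below. (When `Λ` is countable, the infinite subsets of `Λ` are exactly the
members of `[Λ]^ω`.) -/
structure PartitionRegularFunction (Ω : Type u) (Λ : Type v) where
  /-- The family `𝓕` on which `ρ` is defined. -/
  family : Set (Set Ω)
  /-- The function `ρ`. -/
  toFun : Set Ω → Set Λ
  family_nonempty : family.Nonempty
  infinite_of_mem : ∀ F ∈ family, F.Infinite
  diff_mem : ∀ F ∈ family, ∀ K : Set Ω, K.Finite → F \ K ∈ family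
  infinite_toFun : ∀ F ∈ family, (toFun F).Infinite
  /-- Condition (M): monotonicity. -/
  monotone' : ∀ E ∈ family, ∀ F ∈ family, E ⊆ F → toFun E ⊆ toFun F
  /-- Condition (R): partition regularity. -/
  regular' : ∀ F ∈ family, ∀ A B : Set Λ, toFun F = A ∪ B →
    ∃ E ∈ family, toFun E ⊆ A ∨ toFun E ⊆ B
  /-- Condition (S): finite supports. -/
  support' : ∀ F ∈ family, ∃ E ∈ family, E ⊆ F ∧
    ∀ a ∈ toFun E, ∃ K : Set Ω, K.Finite ∧ a ∉ toFun (E \ K)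

namespace PartitionRegularFunction

variable {Ω : Type u} {Λ : Type v}

instance : CoeFun (PartitionRegularFunction Ω Λ) (fun _ => Set Ω → Set Λ) := ⟨toFun⟩

/-- The ideal `I_ρ` of all subsets of `Λ` that contain no set `ρ(F)`, `F ∈ 𝓕`. -/
def ideal (ρ : PartitionRegularFunction Ω Λ) : Set (Set Λ) :=
  {A | ∀ F ∈ ρ.family, ¬ ρ F ⊆ A}

/-- `ρ` is tall: every infinite subset of `Λ` contains an infinite set from `I_ρ`. -/
def Tall (ρ : PartitionRegularFunction Ω Λ) : Prop :=
  ∀ A : Set Λ, A.Infinite → ∃ B : Set Λ, B ⊆ A ∧ B.Infinite ∧ B ∈ ρ.ideal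

/-- The relation `ρ(F) ⊆^ρ B`: there is a finite `K ⊆ Ω` with `ρ(F \ K) ⊆ B`. -/
def AlmostSubset (ρ : PartitionRegularFunction Ω Λ) (F : Set Ω) (B : Set Λ) : Prop :=
  ∃ K : Set Ω, K.Finite ∧ ρ (F \ K) ⊆ B

/-- `ρ` is `P⁻(Λ)`. -/
def IsPMinusWhole (ρ : PartitionRegularFunction Ω Λ) : Prop :=
  ∀ A : ℕ → Set Λ, A 0 = univ → (∀ n, A (n + 1) ⊆ A n) → (∀ n, A n ∉ ρ.ideal) →
    (∀ n, A n \ A (n + 1) ∈ ρ.ideal) →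
    ∃ F ∈ ρ.family, ∀ n, ρ.AlmostSubset F (A n)

/-- `ρ` is `P⁻`. -/
def IsPMinus (ρ : PartitionRegularFunction Ω Λ) : Prop :=
  ∀ A : ℕ → Set Λ, (∀ n, A (n + 1) ⊆ A n) → (∀ n, A n ∉ ρ.ideal) →
    (∀ n, A n \ A (n + 1) ∈ ρ.ideal) →
    ∃ F ∈ ρ.family, ∀ n, ρ.AlmostSubset F (A n)

/-- `ρ` is `P⁺`. -/
def IsPPlus (ρ : PartitionRegularFunction Ω Λ) : Prop :=
  ∀ A : ℕ → Set Λ, (∀ n, A (n + 1) ⊆ A n) → (∀ n, A n ∉ ρ.ideal) →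
    ∃ F ∈ ρ.family, ∀ n, ρ.AlmostSubset F (A n)

/-- `ρ` is weak `P⁺`. -/
def IsWeakPPlus (ρ : PartitionRegularFunction Ω Λ) : Prop :=
  ∀ E ∈ ρ.family, ∃ F ∈ ρ.family, ρ F ⊆ ρ E ∧
    ∀ S : ℕ → Set Ω, (∀ n, S n ∈ ρ.family) → (∀ n, ρ (S n) ⊆ ρ F) →
      (∀ n, ρ (S (n + 1)) ⊆ ρ (S n)) →
      ∃ G ∈ ρ.family, ∀ n, ρ.AlmostSubset G (ρ (S n))

/-- The `ρ`-sequence `f : ρ(F) → X` is `ρ`-convergent to `x`: every neighbourhood `U` of `x`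
contains `f[ρ(F \ K)]` for some finite `K ⊆ Ω`. -/
def ConvergesTo (ρ : PartitionRegularFunction Ω Λ) {X : Type w} [TopologicalSpace X]
    (F : Set Ω) (f : ρ F → X) (x : X) : Prop :=
  ∀ U ∈ 𝓝 x, ∃ K : Set Ω, K.Finite ∧ ∀ a : ρ F, (a : Λ) ∈ ρ (F \ K) → f a ∈ U

/-- `X` belongs to the class `FinBW(ρ)`: for every `f : Λ → X` there is `F ∈ 𝓕` such that the
restriction of `f` to `ρ(F)` is `ρ`-convergent to some point. -/
def FinBW (ρ : PartitionRegularFunction Ω Λ) (X : Type w) [TopologicalSpace X] : Prop :=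
  ∀ f : Λ → X, ∃ F ∈ ρ.family, ∃ x : X, ρ.ConvergesTo F (fun a => f a) x

/-- `X` belongs to the class `hFinBW(ρ)`: for every `ρ`-sequence `f : ρ(E) → X` there is `F ∈ 𝓕`
with `ρ(F) ⊆ ρ(E)` such that the restriction of `f` to `ρ(F)` is `ρ`-convergent to some point. -/
def HFinBW (ρ : PartitionRegularFunction Ω Λ) (X : Type w) [TopologicalSpace X] : Prop :=
  ∀ E ∈ ρ.family, ∀ f : ρ E → X, ∃ F ∈ ρ.family, ∃ h : ρ F ⊆ ρ E, ∃ x : X,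
    ρ.ConvergesTo F (fun a => f (Set.inclusion h a)) x

end PartitionRegularFunction

/-- Property (*): the closure of every countable set is compact and first-countable (as a
subspace). -/
def PropertyStar (X : Type w) [TopologicalSpace X] : Prop :=
  ∀ D : Set X, D.Countable → IsCompact (closure D) ∧ FirstCountableTopology (closure D)

/-- The set `ω₁` of all countable ordinals. -/
def OmegaOne : Type w := (Ordinal.omega.{w} 1).ToType

noncomputable instance : LinearOrder OmegaOne.{w} :=
  inferInstanceAs (LinearOrder (Ordinal.omega.{w} 1).ToType)

/-- `ω₁` carries the order topology. -/
noncomputable instance : TopologicalSpace OmegaOne.{w} := Preorder.topology OmegaOne.{w}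

instance : OrderTopology OmegaOne.{w} := ⟨rfl⟩

/-! The sets ρ(F \ K) generate a filter `tail F`, and ρ-convergence on ρ(F) is convergence along it.
By (R), the sets containing no ρ(F) form a proper ideal; call its members small and all other sets
positive. Then `FinBW` and `HFinBW` are `BWOn B` for `B = univ`, respectively for all positive `B`,
and P⁻(Λ) and P⁻ are `DiagOn B` in the same way: below `B`, countably many small sets can be almost
avoided. Parts 3 and 4 are thus one equivalence with `B` as a parameter. If an infinite Hausdorff
space satisfies `BWOn B`, send the points first covered by the n-th small set to the n-th term of a
sequence with disjoint neighbourhoods; convergence then forces the tail to leave every small set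
(`BWOn.diagOn`). Conversely, in the one-point compactification of a discrete space, a function with
small fibres has only countably many nonempty ones; avoiding them gives convergence to infinity.

If ρ is not tall, some infinite set has only positive infinite subsets, so the range of a convergent
subsequence contains some ρ(F), and (S) turns convergence modulo finite sets into ρ-convergence. If
ρ is tall, Zorn's lemma gives a maximal almost disjoint family of small sets. Its compactified
Mrówka space is sequentially compact by maximality, but the embedding of Λ as the isolated points
has no ρ-convergent restriction.

For ω₁, the limit is the least `b` such that `Iic b` has positive preimage. Under CH, a recursion of
length ω₁ builds an almost disjoint family that treats every function from Λ in turn, so that its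
Mrówka space lies in `FinBW`. Weak P⁺ and P⁺ give a pseudo-intersection of preimages of shrinking
balls, respectively of a neighbourhood base at a cluster point. -/

open Filter

namespace PartitionRegularFunction

variable {Ω : Type u} {Λ : Type v} (ρ : PartitionRegularFunction Ω Λ)

/-! ### The ideal of a partition regular function -/

variable {ρ} in
theorem exists_subset_of_notMem {A : Set Λ} (hA : A ∉ ρ.ideal) : ∃ F ∈ ρ.family, ρ F ⊆ A := by
  simpa [ideal] using hA

variable {ρ} in
theorem notMem_ideal_of_subset {A : Set Λ} {F : Set Ω} (hF : F ∈ ρ.family) (h : ρ F ⊆ A) :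
    A ∉ ρ.ideal := fun hA => hA F hF h

variable {ρ} in
theorem ideal_mono {A B : Set Λ} (h : A ⊆ B) (hB : B ∈ ρ.ideal) : A ∈ ρ.ideal :=
  fun F hF hFA => hB F hF (hFA.trans h)

variable {ρ} in
theorem union_mem_ideal {A B : Set Λ} (hA : A ∈ ρ.ideal) (hB : B ∈ ρ.ideal) :
    A ∪ B ∈ ρ.ideal := by
  intro F hF h
  obtain ⟨E, hE, h' | h'⟩ := ρ.regular' F hF (ρ F ∩ A) (ρ F ∩ B) (by
    rw [← inter_union_distrib_left]; exact (inter_eq_left.2 h).symm)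
  · exact hA E hE (h'.trans inter_subset_right)
  · exact hB E hE (h'.trans inter_subset_right)

theorem mem_ideal_of_finite {A : Set Λ} (hA : A.Finite) : A ∈ ρ.ideal :=
  fun F hF h => ρ.infinite_toFun F hF (hA.subset h)

theorem univ_notMem_ideal : univ ∉ ρ.ideal := by
  obtain ⟨F, hF⟩ := ρ.family_nonempty
  exact notMem_ideal_of_subset hF (subset_univ _)

variable {ρ} in
theorem biUnion_mem_ideal {ι : Type*} {s : Set ι} (hs : s.Finite) {C : ι → Set Λ}
    (hC : ∀ i ∈ s, C i ∈ ρ.ideal) : ⋃ i ∈ s, C i ∈ ρ.ideal := by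
  induction s, hs using Set.Finite.induction_on with
  | empty => simpa using ρ.mem_ideal_of_finite finite_empty
  | insert _ _ ih =>
    rw [biUnion_insert]
    exact union_mem_ideal (hC _ (mem_insert _ _)) (ih fun i hi => hC i (mem_insert_of_mem _ hi))

variable {ρ} in
/-- If a positive set is covered by finitely many sets, one of them has a positive trace on it. -/
theorem exists_inter_notMem_ideal {ι : Type*} {s : Set ι} (hs : s.Finite) {C : ι → Set Λ}
    {B : Set Λ} (hB : B ∉ ρ.ideal) (h : B ⊆ ⋃ i ∈ s, C i) : ∃ i ∈ s, B ∩ C i ∉ ρ.ideal := by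
  by_contra! hc
  refine hB (ideal_mono ?_ (biUnion_mem_ideal hs hc))
  rw [← inter_iUnion₂]
  exact subset_inter subset_rfl h

/-! ### The filter of tails -/

/-- The filter generated by the sets `ρ (F \ K)` with `K` finite. -/
def tail (F : Set Ω) : Filter Λ := ⨅ K ∈ {K : Set Ω | K.Finite}, 𝓟 (ρ (F \ K))

variable {ρ} in
theorem toFun_diff_mono {F : Set Ω} (hF : F ∈ ρ.family) {K L : Set Ω} (hK : K.Finite)
    (hL : L.Finite) (h : K ⊆ L) : ρ (F \ L) ⊆ ρ (F \ K) :=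
  ρ.monotone' _ (ρ.diff_mem F hF L hL) _ (ρ.diff_mem F hF K hK) (sdiff_subset_sdiff_right h)

variable {ρ} in
theorem mem_tail {F : Set Ω} (hF : F ∈ ρ.family) {B : Set Λ} :
    B ∈ ρ.tail F ↔ ρ.AlmostSubset F B := by
  have := Filter.hasBasis_biInf_principal (s := fun K : Set Ω => ρ (F \ K))
    (S := {K : Set Ω | K.Finite}) (fun K hK L hL => ⟨K ∪ L, Set.Finite.union hK hL,
      toFun_diff_mono hF hK (Set.Finite.union hK hL) subset_union_left,
      toFun_diff_mono hF hL (Set.Finite.union hK hL) subset_union_right⟩) ⟨∅, finite_empty⟩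
  rw [tail, this.mem_iff]
  rfl

variable {ρ} in
theorem toFun_diff_subset {F : Set Ω} (hF : F ∈ ρ.family) {K : Set Ω} (hK : K.Finite) :
    ρ (F \ K) ⊆ ρ F :=
  ρ.monotone' _ (ρ.diff_mem F hF K hK) _ hF sdiff_subset

variable {ρ} in
theorem toFun_mem_tail {F : Set Ω} (hF : F ∈ ρ.family) : ρ F ∈ ρ.tail F :=
  (mem_tail hF).2 ⟨∅, finite_empty, toFun_diff_subset hF finite_empty⟩

variable {ρ} in
theorem notMem_ideal_of_mem_tail {F : Set Ω} (hF : F ∈ ρ.family) {B : Set Λ}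
    (hB : B ∈ ρ.tail F) : B ∉ ρ.ideal := by
  obtain ⟨K, hK, h⟩ := (mem_tail hF).1 hB
  exact notMem_ideal_of_subset (ρ.diff_mem F hF K hK) h

variable {ρ} in
theorem infinite_of_mem_tail {F : Set Ω} (hF : F ∈ ρ.family) {B : Set Λ}
    (hB : B ∈ ρ.tail F) : B.Infinite :=
  fun h => notMem_ideal_of_mem_tail hF hB (ρ.mem_ideal_of_finite h)

variable {ρ} in
theorem tail_neBot {F : Set Ω} (hF : F ∈ ρ.family) : (ρ.tail F).NeBot :=
  ⟨fun h => infinite_of_mem_tail hF (B := ∅) (h ▸ mem_bot) finite_empty⟩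

variable {ρ} in
/-- A set which contains `ρ (F \ K)` for a finite `K` contains `ρ F'` for some `F'` whose tails
are tails of `F`. -/
theorem exists_tail_le_of_mem_tail {F : Set Ω} (hF : F ∈ ρ.family) {B : Set Λ}
    (hB : B ∈ ρ.tail F) : ∃ F' ∈ ρ.family, ρ F' ⊆ B ∧ ρ.tail F' ≤ ρ.tail F := by
  obtain ⟨K, hK, h⟩ := (mem_tail hF).1 hB
  refine ⟨F \ K, ρ.diff_mem F hF K hK, h, fun C hC => ?_⟩
  obtain ⟨L, hL, h'⟩ := (mem_tail hF).1 hC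
  refine (mem_tail (ρ.diff_mem F hF K hK)).2 ⟨L, hL, Subset.trans ?_ h'⟩
  exact ρ.monotone' _ (ρ.diff_mem _ (ρ.diff_mem F hF K hK) L hL) _ (ρ.diff_mem F hF L hL)
    (sdiff_subset_sdiff_left sdiff_subset)

variable {ρ} in
theorem convergesTo_iff {X : Type w} [TopologicalSpace X] {F : Set Ω} (hF : F ∈ ρ.family)
    {f : ρ F → X} {g : Λ → X} (hfg : ∀ a : ρ F, f a = g a) {x : X} :
    ρ.ConvergesTo F f x ↔ Tendsto g (ρ.tail F) (𝓝 x) := by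
  refine forall₂_congr fun U hU => ?_
  rw [mem_map, mem_tail hF]
  refine exists_congr fun K => and_congr_right fun hK => ⟨fun h a ha => ?_, fun h a ha => ?_⟩
  · have := h ⟨a, toFun_diff_subset hF hK ha⟩ ha
    rwa [hfg] at this
  · rw [hfg]
    exact h ha

variable {ρ} in
/-- If `Λ` is enumerated, then some strictly increasing sequence of indices converges along the
tails of `F`. -/
theorem exists_strictMono_tendsto_tail [Countable Ω] (e : Λ ≃ ℕ) {F : Set Ω}
    (hF : F ∈ ρ.family) :
    ∃ φ : ℕ → ℕ, StrictMono φ ∧ Tendsto (fun n => e.symm (φ n)) atTop (ρ.tail F) := by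
  obtain ⟨i, hi⟩ := exists_injective_nat Ω
  have hK : ∀ n, (i ⁻¹' Iio n).Finite := fun n => (finite_Iio n).preimage hi.injOn
  -- The finite sets `i ⁻¹' Iio n` exhaust Ω, so taking the n-th term from the n-th set ρ(F \
  -- i⁻¹(Iio n)) puts the sequence eventually in every ρ(F \ K).
  obtain ⟨φ, hφ, h⟩ := Filter.extraction_forall_of_frequently
    (P := fun n k => e.symm k ∈ ρ (F \ i ⁻¹' Iio n)) (fun n => by
      rw [Nat.frequently_atTop_iff_infinite]
      exact (ρ.infinite_toFun _ (ρ.diff_mem F hF _ (hK n))).preimage (by simp))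
  refine ⟨φ, hφ, fun B hB => ?_⟩
  obtain ⟨K, hKf, hKB⟩ := (mem_tail hF).1 hB
  obtain ⟨m, hm⟩ := (hKf.image i).bddAbove
  rw [mem_map]
  filter_upwards [eventually_gt_atTop m] with n hn
  exact hKB (toFun_diff_mono hF hKf (hK n)
    (fun a ha => (hm (mem_image_of_mem i ha)).trans_lt hn) (h n))

/-! ### Relativized classes of spaces -/

/-- Every function to `X` is convergent along the tails of some `F` with `ρ F ⊆ B`. -/
def BWOn (B : Set Λ) (X : Type w) [TopologicalSpace X] : Prop :=
  ∀ f : Λ → X, ∃ F ∈ ρ.family, ρ F ⊆ B ∧ ∃ x, Tendsto f (ρ.tail F) (𝓝 x)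

theorem finBW_iff {X : Type w} [TopologicalSpace X] : ρ.FinBW X ↔ ρ.BWOn univ X := by
  refine forall_congr' fun f => exists_congr fun F => and_congr_right fun hF => ?_
  simp only [subset_univ, true_and]
  exact exists_congr fun x => convergesTo_iff hF fun _ => rfl

theorem hFinBW_iff {X : Type w} [TopologicalSpace X] :
    ρ.HFinBW X ↔ ∀ B ∉ ρ.ideal, ρ.BWOn B X := by
  constructor
  · intro h B hB f
    obtain ⟨E, hE, hEB⟩ := exists_subset_of_notMem hB
    obtain ⟨F, hF, hFE, x, hx⟩ := h E hE fun a => f a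
    exact ⟨F, hF, hFE.trans hEB, x, (convergesTo_iff hF fun _ => rfl).1 hx⟩
  · intro h E hE f
    obtain ⟨a, ha⟩ := (ρ.infinite_toFun E hE).nonempty
    -- The value chosen off ρ(E) is irrelevant, since ρ(F) ⊆ ρ(E).
    obtain ⟨F, hF, hFE, x, hx⟩ := h (ρ E) (notMem_ideal_of_subset hE subset_rfl)
      (Function.extend Subtype.val f fun _ => f ⟨a, ha⟩)
    refine ⟨F, hF, hFE, x, (convergesTo_iff hF fun b => ?_).2 hx⟩
    exact (Subtype.val_injective.extend_apply f _ (inclusion hFE b)).symm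

variable {ρ} in
theorem exists_tendsto_of_fiber_notMem {B : Set Λ} {X : Type w} [TopologicalSpace X]
    {f : Λ → X} {x : X} (h : B ∩ f ⁻¹' {x} ∉ ρ.ideal) :
    ∃ F ∈ ρ.family, ρ F ⊆ B ∧ ∃ x, Tendsto f (ρ.tail F) (𝓝 x) := by
  obtain ⟨F, hF, hFB⟩ := exists_subset_of_notMem h
  refine ⟨F, hF, hFB.trans inter_subset_left, x,
    tendsto_const_nhds.congr' (mem_of_superset (toFun_mem_tail hF) fun a ha => ?_)⟩
  exact (hFB ha).2.symm

theorem bwOn_of_finite {B : Set Λ} (hB : B ∉ ρ.ideal) (X : Type w) [TopologicalSpace X]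
    [Finite X] : ρ.BWOn B X := by
  intro f
  obtain ⟨x, -, hx⟩ := exists_inter_notMem_ideal (C := fun x => f ⁻¹' {x}) (finite_univ (α := X))
    hB (fun a _ => by simp)
  exact exists_tendsto_of_fiber_notMem hx

variable {ρ} in
theorem BWOn.seqCompactSpace [Countable Ω] [Countable Λ] [Infinite Λ] {B : Set Λ} {X : Type w}
    [TopologicalSpace X] (h : ρ.BWOn B X) : SeqCompactSpace X := by
  obtain ⟨e⟩ := nonempty_equiv_of_countable (α := Λ) (β := ℕ)
  refine ⟨fun s _ => ?_⟩
  obtain ⟨F, hF, -, x, hx⟩ := h fun a => s (e a)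
  obtain ⟨φ, hφ, h'⟩ := exists_strictMono_tendsto_tail e hF
  exact ⟨x, mem_univ x, φ, hφ, by simpa [Function.comp_def] using hx.comp h'⟩

/-! ### Diagonalization against countably many small sets -/

/-- Below `B` one can almost avoid any countable family of sets from the ideal. -/
def DiagOn (B : Set Λ) : Prop :=
  ∀ C : ℕ → Set Λ, (∀ n, C n ∈ ρ.ideal) →
    ∃ F ∈ ρ.family, ρ F ⊆ B ∧ ∀ n, (C n)ᶜ ∈ ρ.tail F

variable {ρ} in
-- Decreasing sequences with small differences and sequences of small sets encode each other: pass
-- to the successive differences, or remove more and more of the small sets from `B`.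
theorem diagOn_iff {B : Set Λ} (hB : B ∉ ρ.ideal) :
    ρ.DiagOn B ↔ ∀ A : ℕ → Set Λ, A 0 = B → (∀ n, A (n + 1) ⊆ A n) → (∀ n, A n ∉ ρ.ideal) →
      (∀ n, A n \ A (n + 1) ∈ ρ.ideal) → ∃ F ∈ ρ.family, ∀ n, ρ.AlmostSubset F (A n) := by
  constructor
  · intro h A h0 _ _ hd
    obtain ⟨F, hF, hFB, hC⟩ := h _ hd
    refine ⟨F, hF, fun n => (mem_tail hF).1 ?_⟩
    induction n with
    | zero => exact h0 ▸ mem_of_superset (toFun_mem_tail hF) hFB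
    | succ n ih =>
      filter_upwards [ih, hC n] with a ha ha'
      by_contra hn
      exact ha' ⟨ha, hn⟩
  · intro h C hC
    obtain ⟨F, hF, hA⟩ := h (fun n => B \ ⋃ i ∈ Iio n, C i) (by simp)
      (fun n => sdiff_subset_sdiff_right (biUnion_subset_biUnion_left (Iio_subset_Iio n.le_succ)))
      (fun n hn => hB (ideal_mono (subset_sdiff_union B (⋃ i ∈ Iio n, C i))
        (union_mem_ideal hn (biUnion_mem_ideal (finite_Iio n) fun i _ => hC i))))
      (fun n => by
        refine ideal_mono ?_ (hC n)
        rintro a ⟨⟨haB, ha⟩, ha'⟩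
        have haU : a ∈ ⋃ i ∈ Iio (n + 1), C i := by
          by_contra hn
          exact ha' ⟨haB, hn⟩
        simp only [mem_iUnion, mem_Iio, not_exists, exists_prop, not_and] at ha haU
        obtain ⟨i, hi, hai⟩ := haU
        rcases Nat.lt_succ_iff_lt_or_eq.1 hi with hi | rfl
        · exact absurd hai (ha i hi)
        · exact hai)
    -- Here ρ(F) is only almost contained in `B`; a tail of it is genuinely contained.
    obtain ⟨F', hF', hB', hle⟩ := exists_tail_le_of_mem_tail hF ((mem_tail hF).2 (hA 0))
    refine ⟨F', hF', hB'.trans sdiff_subset, fun n => hle ?_⟩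
    filter_upwards [(mem_tail hF).2 (hA (n + 1))] with a ha hn
    exact ha.2 (mem_biUnion (mem_Iio.2 n.lt_succ_self) hn)

theorem isPMinusWhole_iff : ρ.IsPMinusWhole ↔ ρ.DiagOn univ :=
  (diagOn_iff ρ.univ_notMem_ideal).symm

theorem isPMinus_iff : ρ.IsPMinus ↔ ∀ B ∉ ρ.ideal, ρ.DiagOn B := by
  constructor
  · exact fun h B hB => (diagOn_iff hB).2 fun A _ => h A
  · exact fun h A hA hp => (diagOn_iff (hp 0)).1 (h _ (hp 0)) A rfl hA hp

variable {ρ} in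
theorem DiagOn.exists_of_countable {B : Set Λ} (h : ρ.DiagOn B) {ι : Type*} [Countable ι]
    {C : ι → Set Λ} (hC : ∀ i, C i ∈ ρ.ideal) :
    ∃ F ∈ ρ.family, ρ F ⊆ B ∧ ∀ i, (C i)ᶜ ∈ ρ.tail F := by
  obtain ⟨i, hi⟩ := exists_injective_nat ι
  obtain ⟨F, hF, hFB, hFC⟩ := h (fun n => ⋃ j ∈ i ⁻¹' {n}, C j)
    (fun n => biUnion_mem_ideal ((finite_singleton n).preimage hi.injOn) fun j _ => hC j)
  refine ⟨F, hF, hFB, fun j => mem_of_superset (hFC (i j)) (compl_subset_compl.2 ?_)⟩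
  exact subset_biUnion_of_mem (u := C) (mem_singleton (i j))

variable {ρ} in
/-- If all fibers of `f` on `B` are small, then `f` can be made to almost avoid all points, and
countably many small sets as well. -/
theorem DiagOn.exists_of_fibers [Countable Λ] {B : Set Λ} (h : ρ.DiagOn B) {X : Type*}
    {f : Λ → X} (hf : ∀ x, B ∩ f ⁻¹' {x} ∈ ρ.ideal) {ι : Type*} [Countable ι]
    {C : ι → Set Λ} (hC : ∀ i, C i ∈ ρ.ideal) :
    ∃ F ∈ ρ.family, ρ F ⊆ B ∧ (∀ x, ∀ᶠ a in ρ.tail F, f a ≠ x) ∧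
      ∀ i, (C i)ᶜ ∈ ρ.tail F := by
  -- Indexing fibres by Λ keeps the family countable even when the space is not.
  obtain ⟨F, hF, hFB, hFC⟩ := h.exists_of_countable
    (C := Sum.elim (fun a => B ∩ f ⁻¹' {f a}) C) (by rintro (a | i); exacts [hf _, hC i])
  refine ⟨F, hF, hFB, fun x => ?_, fun i => hFC (Sum.inr i)⟩
  by_cases hx : ∃ b, f b = x
  · obtain ⟨b, rfl⟩ := hx
    filter_upwards [toFun_mem_tail hF, hFC (Sum.inl b)] with a ha hab he
    exact hab ⟨hFB ha, he⟩
  · exact Eventually.of_forall fun a ha => hx ⟨a, ha⟩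

variable {ρ} in
-- A limit inside `U m` would put the small fibre over `m` into the tail filter. A limit outside `U
-- m` differs from `x m`, so the Hausdorff property keeps the tail away from that fibre. Hence the
-- colouring leaves every finite set of colours, and with it each `C n`.
theorem BWOn.diagOn {B : Set Λ} {X : Type w} [TopologicalSpace X] [T2Space X]
    [Infinite X] (h : ρ.BWOn B X) : ρ.DiagOn B := by
  classical
  obtain ⟨U, hUi, hUo, hUd⟩ := exists_seq_infinite_isOpen_pairwise_disjoint X
  choose x hx using fun n => (hUi n).nonempty
  have hxU : ∀ {m n}, x m ∈ U n → m = n := fun {m n} hm => by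
    by_contra hmn
    exact (hUd hmn).le_bot ⟨hx m, hm⟩
  have key : ∀ C : ℕ → Set Λ, (∀ n, C n ∈ ρ.ideal) → ∀ f : Λ → ℕ,
      (∀ n, B ∩ f ⁻¹' {n} ∈ ρ.ideal) → (∀ n, ∀ a ∈ C n, f a ≤ n) →
      ∃ F ∈ ρ.family, ρ F ⊆ B ∧ ∀ n, (C n)ᶜ ∈ ρ.tail F := by
    intro C hC f hf hfC
    obtain ⟨F, hF, hFB, y, hy⟩ := h fun a => x (f a)
    refine ⟨F, hF, hFB, fun n => ?_⟩
    have hfar : ∀ m, ∀ᶠ a in ρ.tail F, f a ≠ m := by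
      intro m
      by_cases hym : y ∈ U m
      · refine absurd (hf m) (notMem_ideal_of_mem_tail hF ?_)
        filter_upwards [toFun_mem_tail hF, hy ((hUo m).mem_nhds hym)] with a ha ha'
        exact ⟨hFB ha, hxU ha'⟩
      · have hne : y ≠ x m := fun he => hym (he ▸ hx m)
        filter_upwards [hy.eventually_ne hne] with a ha he
        exact ha (congrArg x he)
    filter_upwards [(eventually_all_finite (finite_Iic n)).2 fun m _ => hfar m] with a ha haC
    exact ha (f a) (hfC n a haC) rfl
  intro C hC
  by_cases hr : B \ ⋃ n, C n ∈ ρ.ideal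
  · refine key C hC (fun a => if ha : ∃ n, a ∈ C n then Nat.find ha else 0) (fun n => ?_) ?_
    · refine ideal_mono ?_ (union_mem_ideal hr (hC n))
      rintro a ⟨haB, ha⟩
      by_cases h' : ∃ n, a ∈ C n
      · right
        simp only [mem_preimage, h', dite_true, mem_singleton_iff] at ha
        exact ha ▸ Nat.find_spec h'
      · left
        exact ⟨haB, by simpa using h'⟩
    · intro n a ha
      have h' : ∃ n, a ∈ C n := ⟨n, ha⟩
      simp only [h', dite_true]
      exact Nat.find_min' h' ha
  · obtain ⟨F, hF, hFB⟩ := exists_subset_of_notMem hr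
    refine ⟨F, hF, hFB.trans sdiff_subset, fun n => mem_of_superset (toFun_mem_tail hF) ?_⟩
    exact fun a ha hn => (hFB ha).2 (mem_iUnion_of_mem n hn)

end PartitionRegularFunction

/-! ### Mrówka spaces -/

/-- The one-point compactification of the Mrówka space of a family `A` of subsets of `N`: its
points are the elements of `N`, the indices of the family, and a point at infinity. -/
def MrowkaSpace {N I : Type w} (_ : I → Set N) : Type w := Option (N ⊕ I)

namespace MrowkaSpace

variable {N I : Type w} {A : I → Set N}

/-- The isolated point `n`. -/
def point (n : N) : MrowkaSpace A := some (Sum.inl n)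

/-- The limit point of `A i`. -/
def limit (i : I) : MrowkaSpace A := some (Sum.inr i)

/-- The point at infinity. -/
def infty : MrowkaSpace A := none

theorem eq_cases (x : MrowkaSpace A) : (∃ n, x = point n) ∨ (∃ i, x = limit i) ∨ x = infty := by
  rcases x with _ | n | i
  exacts [Or.inr (Or.inr rfl), Or.inl ⟨n, rfl⟩, Or.inr (Or.inl ⟨i, rfl⟩)]

theorem point_injective : Function.Injective (point (A := A)) :=
  (Option.some_injective _).comp Sum.inl_injective

theorem limit_injective : Function.Injective (limit (A := A)) :=
  (Option.some_injective _).comp Sum.inr_injective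

@[simp] theorem point_inj {m n : N} : (point m : MrowkaSpace A) = point n ↔ m = n :=
  point_injective.eq_iff

@[simp] theorem limit_inj {i j : I} : (limit i : MrowkaSpace A) = limit j ↔ i = j :=
  limit_injective.eq_iff

@[simp] theorem point_ne_limit {n : N} {i : I} : (point n : MrowkaSpace A) ≠ limit i := nofun

@[simp] theorem limit_ne_point {n : N} {i : I} : (limit i : MrowkaSpace A) ≠ point n := nofun

@[simp] theorem infty_ne_limit {i : I} : (infty : MrowkaSpace A) ≠ limit i := nofun

@[simp] theorem infty_ne_point {n : N} : (infty : MrowkaSpace A) ≠ point n := nofun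

/-- The underlying element of `N`, if there is one. -/
def toOption : MrowkaSpace A → Option N
  | some (Sum.inl n) => some n
  | _ => none

theorem toOption_eq_some {x : MrowkaSpace A} {n : N} : toOption x = some n ↔ x = point n := by
  rcases eq_cases x with ⟨m, rfl⟩ | ⟨i, rfl⟩ | rfl
  · rw [point_inj]
    exact Option.some_inj
  · exact ⟨nofun, nofun⟩
  · exact ⟨nofun, nofun⟩

variable (A) in
/-- The basic clopen neighbourhood of `limit i`. -/
def cell (i : I) : Set (MrowkaSpace A) := insert (limit i) (point '' A i)

@[simp] theorem point_mem_cell {n : N} {i : I} : point n ∈ cell A i ↔ n ∈ A i := by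
  simp [cell]

@[simp] theorem limit_mem_cell {i j : I} : limit j ∈ cell A i ↔ j = i := by
  simp [cell]

@[simp] theorem infty_notMem_cell {i : I} : infty ∉ cell A i := by
  simp [cell, eq_comm]

/-- The topology in which all points of `N` and all cells are clopen. -/
instance : TopologicalSpace (MrowkaSpace A) :=
  (⨅ n : N, TopologicalSpace.induced (· = point n) ⊥) ⊓
    ⨅ i : I, TopologicalSpace.induced (· ∈ cell A i) ⊥

/-- The topology is initial for two-valued maps, so convergence means that each of these maps is
eventually equal to its value at `x`. -/
theorem tendsto_nhds {α : Type*} {f : α → MrowkaSpace A} {l : Filter α} {x : MrowkaSpace A} :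
    Tendsto f l (𝓝 x) ↔ (∀ n, ∀ᶠ a in l, f a = point n ↔ x = point n) ∧
      ∀ i, ∀ᶠ a in l, f a ∈ cell A i ↔ x ∈ cell A i := by
  have h : 𝓝 x = (⨅ n : N, comap (· = point n) (pure (x = point n))) ⊓
      ⨅ i : I, comap (· ∈ cell A i) (pure (x ∈ cell A i)) := by
    refine (_root_.nhds_inf (t₁ := ⨅ n : N, TopologicalSpace.induced (· = point n) ⊥)
      (t₂ := ⨅ i : I, TopologicalSpace.induced (· ∈ cell A i) ⊥)).trans ?_
    rw [_root_.nhds_iInf, _root_.nhds_iInf]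
    simp only [@nhds_induced _ _ ⊥, @nhds_discrete Prop ⊥ (@DiscreteTopology.mk _ ⊥ rfl)]
  rw [h, tendsto_inf, tendsto_iInf, tendsto_iInf]
  simp only [tendsto_comap_iff, tendsto_pure, Function.comp_apply, eq_iff_iff]

theorem tendsto_infty {α : Type*} {f : α → MrowkaSpace A} {l : Filter α} :
    Tendsto f l (𝓝 infty) ↔ (∀ n, ∀ᶠ a in l, f a ≠ point n) ∧
      ∀ i, ∀ᶠ a in l, f a ∉ cell A i := by
  simp [tendsto_nhds]

theorem finite_cell_inter {i j : I} (h : i ≠ j) (hA : (A i ∩ A j).Finite) :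
    (cell A i ∩ cell A j).Finite := by
  refine (hA.image point).subset ?_
  rintro x ⟨hi, hj⟩
  rcases eq_cases x with ⟨n, rfl⟩ | ⟨k, rfl⟩ | rfl
  · exact mem_image_of_mem _ ⟨by simpa using hi, by simpa using hj⟩
  · exact absurd ((limit_mem_cell.1 hi).symm.trans (limit_mem_cell.1 hj)) h
  · simp at hi

/-- A function which is in a cell eventually, and eventually avoids every point, converges to the
limit point of the cell. -/
theorem tendsto_limit (hA : ∀ i j, i ≠ j → (A i ∩ A j).Finite) {α : Type*}
    {f : α → MrowkaSpace A} {l : Filter α} (hf : ∀ x, ∀ᶠ a in l, f a ≠ x) {i : I}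
    (hi : ∀ᶠ a in l, f a ∈ cell A i) : Tendsto f l (𝓝 (limit i)) := by
  refine tendsto_nhds.2 ⟨fun n => by simpa using hf (point n), fun j => ?_⟩
  by_cases hij : i = j
  · subst hij
    simpa using hi
  · simp only [limit_mem_cell, hij, iff_false]
    filter_upwards [hi, (eventually_all_finite (finite_cell_inter hij (hA i j hij))).2
      fun x _ => hf x] with a ha ha' haj
    exact ha' (f a) ⟨ha, haj⟩ rfl

/-- The clopen points and cells separate all elements, and an ultrafilter determines on which side
of each of them its limits lie. -/
instance : T2Space (MrowkaSpace A) := by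
  refine t2_iff_ultrafilter.2 fun {x y} 𝒰 hx hy => ?_
  obtain ⟨hx1, hx2⟩ := tendsto_nhds.1 (tendsto_id'.2 hx)
  obtain ⟨hy1, hy2⟩ := tendsto_nhds.1 (tendsto_id'.2 hy)
  have h1 : ∀ n, x = point n ↔ y = point n := fun n => by
    obtain ⟨z, hz, hz'⟩ := ((hx1 n).and (hy1 n)).exists
    exact hz.symm.trans hz'
  have h2 : ∀ i, x ∈ cell A i ↔ y ∈ cell A i := fun i => by
    obtain ⟨z, hz, hz'⟩ := ((hx2 i).and (hy2 i)).exists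
    exact hz.symm.trans hz'
  rcases eq_cases x with ⟨n, rfl⟩ | ⟨i, rfl⟩ | rfl
  · exact ((h1 n).1 rfl).symm
  · rcases eq_cases y with ⟨n, rfl⟩ | ⟨j, rfl⟩ | rfl
    · exact (h1 n).2 rfl
    · simpa using (h2 j).2
    · simpa using h2 i
  · rcases eq_cases y with ⟨n, rfl⟩ | ⟨j, rfl⟩ | rfl
    · simpa using h1 n
    · simpa using h2 j
    · rfl

/-- A nonprincipal ultrafilter converges to the limit point of a cell that it contains, and to
infinity if it contains none. -/
theorem compactSpace (hA : ∀ i j, i ≠ j → (A i ∩ A j).Finite) : CompactSpace (MrowkaSpace A) := by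
  refine ⟨isCompact_iff_ultrafilter_le_nhds.2 fun 𝒰 _ => ?_⟩
  by_cases h : ∀ x, ∀ᶠ y in (𝒰 : Filter (MrowkaSpace A)), y ≠ x
  · by_cases hi : ∃ i, ∀ᶠ y in (𝒰 : Filter (MrowkaSpace A)), y ∈ cell A i
    · obtain ⟨i, hi⟩ := hi
      exact ⟨limit i, mem_univ _, tendsto_id'.1 (tendsto_limit hA h hi)⟩
    · simp only [not_exists, ← Ultrafilter.eventually_not] at hi
      exact ⟨infty, mem_univ _, tendsto_id'.1 (tendsto_infty.2
        ⟨fun n => h _, hi⟩)⟩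
  · simp only [not_forall, ← Ultrafilter.eventually_not, not_not] at h
    obtain ⟨x, hx⟩ := h
    refine ⟨x, mem_univ _, tendsto_id'.1 ?_⟩
    refine tendsto_const_nhds.congr' (f₁ := fun _ => x) ?_
    filter_upwards [hx] with y hy
    exact hy.symm

theorem separableSpace [Countable N] (hA : ∀ i j, i ≠ j → (A i ∩ A j).Finite)
    (hi : ∀ i, (A i).Infinite) :
    TopologicalSpace.SeparableSpace (MrowkaSpace A) := by
  -- The point at infinity is adjoined because it can be isolated, for instance when finitely many
  -- sets make up the family and cover `N`.
  refine ⟨insert infty (range point), (countable_range _).insert _, fun x => ?_⟩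
  rcases eq_cases x with ⟨n, rfl⟩ | ⟨i, rfl⟩ | rfl
  · exact subset_closure (Or.inr (mem_range_self n))
  · have : (cofinite ⊓ 𝓟 (A i)).NeBot := cofinite_inf_principal_neBot_iff.2 (hi i)
    refine closure_mono (subset_insert _ _) (mem_closure_of_tendsto (f := point)
      (b := cofinite ⊓ 𝓟 (A i)) (tendsto_limit hA (fun x => ?_) ?_)
      (Eventually.of_forall mem_range_self))
    · exact (point_injective.tendsto_cofinite.eventually (eventually_cofinite_ne x)).filter_mono
        inf_le_left
    · exact mem_of_superset (mem_inf_of_right (mem_principal_self _)) fun n hn =>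
        point_mem_cell.2 hn
  · exact subset_closure (mem_insert _ _)

theorem mk_eq : Cardinal.mk (MrowkaSpace A) = Cardinal.mk N + Cardinal.mk I + 1 := by
  simp [MrowkaSpace, Cardinal.mk_option]

end MrowkaSpace

/-! ### Convergence along tails in Mrówka spaces -/

namespace PartitionRegularFunction

variable {Ω : Type u} {Λ : Type v} {ρ : PartitionRegularFunction Ω Λ}

open MrowkaSpace

/-- The one-point compactification of a discrete space. -/
theorem DiagOn.bwOn_mrowkaSpace_of_isEmpty [Countable Λ] {B : Set Λ} (h : ρ.DiagOn B)
    {N I : Type w} [IsEmpty N] (A : I → Set N) : ρ.BWOn B (MrowkaSpace A) := by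
  intro f
  by_cases hf : ∀ x, B ∩ f ⁻¹' {x} ∈ ρ.ideal
  · obtain ⟨F, hF, hFB, hx, -⟩ := h.exists_of_fibers hf (C := fun i : Empty => i.elim) nofun
    refine ⟨F, hF, hFB, infty, tendsto_infty.2 ⟨fun n => hx _, fun i => ?_⟩⟩
    have : point '' A i = (∅ : Set (MrowkaSpace A)) := by simp [Set.eq_empty_of_isEmpty]
    simpa [cell, this] using hx (limit i)
  · push Not at hf
    exact exists_tendsto_of_fiber_notMem hf.choose_spec

/-- A finite discrete space, or the one-point compactification of a discrete space of size κ,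
obtained as a Mrówka space with no isolated part `N`. One space serves all `B`, hence both the plain
and the hereditary class. -/
theorem exists_compact_bwOn [Countable Λ] (ρ : PartitionRegularFunction Ω Λ) (κ : Cardinal.{w}) :
    ∃ (X : Type w) (_ : TopologicalSpace X), T2Space X ∧ CompactSpace X ∧ Cardinal.mk X = κ ∧
      ∀ B ∉ ρ.ideal, ρ.DiagOn B → ρ.BWOn B X := by
  rcases lt_or_ge κ Cardinal.aleph0 with hκ | hκ
  · have : Finite κ.out := by rwa [← Cardinal.mk_lt_aleph0_iff, Cardinal.mk_out]
    refine ⟨κ.out, ⊥, ?_, ?_, Cardinal.mk_out κ, fun B hB _ => ?_⟩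
    · let _ : TopologicalSpace κ.out := ⊥
      have : DiscreteTopology κ.out := ⟨rfl⟩
      infer_instance
    · let _ : TopologicalSpace κ.out := ⊥
      exact Finite.compactSpace
    · let _ : TopologicalSpace κ.out := ⊥
      exact ρ.bwOn_of_finite hB _
  · refine ⟨MrowkaSpace fun _ : κ.out => (∅ : Set PEmpty), inferInstance, inferInstance,
      compactSpace (by simp), ?_, fun B _ h => h.bwOn_mrowkaSpace_of_isEmpty _⟩
    rw [mk_eq]
    simp [Cardinal.add_one_eq hκ]

/-- For partition regular functions with property `P⁻`, only functions with small fibers and small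
preimages of cells have to be considered. -/
theorem bwOn_mrowkaSpace [Countable Λ] (hρ : ρ.IsPMinus) {N I : Type w} {A : I → Set N}
    (hA : ∀ i j, i ≠ j → (A i ∩ A j).Finite)
    (h : ∀ f : Λ → MrowkaSpace A, (∀ x, f ⁻¹' {x} ∈ ρ.ideal) → (∀ i, f ⁻¹' cell A i ∈ ρ.ideal) →
      f ⁻¹' range point ∉ ρ.ideal →
      ∃ F ∈ ρ.family, (∀ x, ∀ᶠ a in ρ.tail F, f a ≠ x) ∧
        ∀ i, ∀ᶠ a in ρ.tail F, f a ∉ cell A i) :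
    ρ.BWOn univ (MrowkaSpace A) := by
  rw [isPMinus_iff] at hρ
  intro f
  by_cases hf : ∀ x, f ⁻¹' {x} ∈ ρ.ideal
  · have hfB : ∀ B : Set Λ, ∀ x, B ∩ f ⁻¹' {x} ∈ ρ.ideal :=
      fun B x => ideal_mono inter_subset_right (hf x)
    by_cases hc : ∀ i, f ⁻¹' cell A i ∈ ρ.ideal
    · by_cases hp : f ⁻¹' range point ∈ ρ.ideal
      -- Off the isolated points a cell contains only its limit point, so avoiding single values
      -- already gives convergence to infinity.
      · have hp' : (f ⁻¹' range point)ᶜ ∉ ρ.ideal := fun hp' =>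
          ρ.univ_notMem_ideal (union_compl_self (f ⁻¹' range point) ▸ union_mem_ideal hp hp')
        obtain ⟨F, hF, hFB, hx, -⟩ := (hρ _ hp').exists_of_fibers (hfB _)
          (C := fun i : Empty => i.elim) nofun
        refine ⟨F, hF, subset_univ _, infty, tendsto_infty.2 ⟨fun n => hx _, fun i => ?_⟩⟩
        filter_upwards [toFun_mem_tail hF, hx (limit i)] with a ha ha'
        rintro (h' | ⟨n, -, h'⟩)
        exacts [ha' h', hFB ha ⟨n, h'⟩]
      · obtain ⟨F, hF, hx, hi⟩ := h f hf hc hp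
        exact ⟨F, hF, subset_univ _, infty, tendsto_infty.2 ⟨fun n => hx _, hi⟩⟩
    · push Not at hc
      obtain ⟨i, hi⟩ := hc
      obtain ⟨F, hF, hFB, hx, -⟩ := (hρ _ hi).exists_of_fibers (hfB _)
        (C := fun i : Empty => i.elim) nofun
      exact ⟨F, hF, subset_univ _, limit i,
        tendsto_limit hA hx (mem_of_superset (toFun_mem_tail hF) hFB)⟩
  · push Not at hf
    obtain ⟨x, hx⟩ := hf
    exact exists_tendsto_of_fiber_notMem (x := x) (by rwa [univ_inter])

end PartitionRegularFunction

namespace PartitionRegularFunction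

variable {Ω : Type u} {Λ : Type v} {ρ : PartitionRegularFunction Ω Λ}

/-! ### Compact metric spaces and spaces with property (*) -/

/-- By total boundedness and (R), ρ(F) can be shrunk repeatedly so that its images lie in balls of
radius tending to 0. Along a pseudo-intersection of these sets the function is Cauchy. -/
theorem IsWeakPPlus.hFinBW (hρ : ρ.IsWeakPPlus) (X : Type w) [MetricSpace X] [CompactSpace X] :
    ρ.HFinBW X := by
  rw [hFinBW_iff]
  intro B hB f
  obtain ⟨E, hE, hEB⟩ := exists_subset_of_notMem hB
  obtain ⟨F, hF, hFE, hG⟩ := hρ E hE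
  have step : ∀ (T : Set Ω) (n : ℕ), T ∈ ρ.family → ∃ T' ∈ ρ.family, ρ T' ⊆ ρ T ∧
      ∃ x, f '' ρ T' ⊆ Metric.ball x (1 / (n + 1)) := by
    intro T n hT
    obtain ⟨t, ht, hc⟩ := Metric.totallyBounded_iff.1
      (isCompact_univ (X := X)).totallyBounded (1 / (n + 1 : ℝ)) (by positivity)
    obtain ⟨x, -, hx⟩ := exists_inter_notMem_ideal ht
      (C := fun x => f ⁻¹' Metric.ball x (1 / (n + 1)))
      (notMem_ideal_of_subset hT subset_rfl) (fun a _ => by simpa using hc (mem_univ (f a)))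
    obtain ⟨T', hT', h⟩ := exists_subset_of_notMem hx
    exact ⟨T', hT', h.trans inter_subset_left, x,
      image_subset_iff.2 (h.trans inter_subset_right)⟩
  choose! g hg hgs c hc using step
  let S : ℕ → Set Ω := fun n => Nat.rec F (fun n T => g T n) n
  have hS : ∀ n, S n ∈ ρ.family := fun n => by
    induction n with
    | zero => exact hF
    | succ n ih => exact hg _ _ ih
  have hSs : ∀ n, ρ (S (n + 1)) ⊆ ρ (S n) := fun n => hgs _ _ (hS n)
  obtain ⟨G, hGf, hGS⟩ :=
    hG S hS (fun n => antitone_nat_of_succ_le (f := fun n => ρ (S n)) hSs n.zero_le) hSs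
  have hGS' : ∀ n, ρ (S n) ∈ ρ.tail G := fun n => (mem_tail hGf).2 (hGS n)
  -- Weak P⁺ does not place ρ(G) inside ρ(E); a tail of `G` is inside.
  obtain ⟨G', hG', hG'S, hle⟩ := exists_tail_le_of_mem_tail hGf (hGS' 0)
  have := tail_neBot hGf
  have hcauchy : Cauchy (map f (ρ.tail G)) := by
    refine Metric.cauchy_iff.2 ⟨inferInstance, fun ε hε => ?_⟩
    obtain ⟨n, hn⟩ := exists_nat_one_div_lt (half_pos hε)
    refine ⟨f '' ρ (S (n + 1)), image_mem_map (hGS' (n + 1)), fun x hx y hy => ?_⟩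
    have hx' := Metric.mem_ball.1 (hc _ n (hS n) hx)
    have hy' := Metric.mem_ball.1 (hc _ n (hS n) hy)
    linarith [dist_triangle_right x y (c (S n) n (hS n))]
  obtain ⟨x, hx⟩ := CompleteSpace.complete hcauchy
  exact ⟨G', hG', hG'S.trans (hFE.trans hEB), x, (map_mono hle).trans hx⟩

/-- By compactness some point has only neighbourhoods with positive preimage in `B`: otherwise
finitely many small sets would cover `B`. P⁺ is applied to the preimages of a countable base at that
point. -/
theorem IsPPlus.bwOn (hρ : ρ.IsPPlus) {B : Set Λ} (hB : B ∉ ρ.ideal) {X : Type w}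
    [TopologicalSpace X] [CompactSpace X] [FirstCountableTopology X] : ρ.BWOn B X := by
  intro f
  obtain ⟨x, hx⟩ : ∃ x, ∀ U ∈ 𝓝 x, B ∩ f ⁻¹' U ∉ ρ.ideal := by
    by_contra! h
    choose U hU hI using h
    obtain ⟨t, -, ht⟩ := isCompact_univ.elim_nhds_subcover U fun x _ => hU x
    obtain ⟨x, -, hx⟩ := exists_inter_notMem_ideal t.finite_toSet (C := fun x => f ⁻¹' U x) hB
      (fun a _ => by simpa using ht (mem_univ (f a)))
    exact hx (hI x)
  obtain ⟨U, hU⟩ := (𝓝 x).exists_antitone_basis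
  obtain ⟨F, hF, hFA⟩ := hρ (fun n => B ∩ f ⁻¹' U n)
    (fun n => inter_subset_inter_right _ (preimage_mono (hU.antitone n.le_succ)))
    (fun n => hx _ (hU.mem n))
  obtain ⟨F', hF', hB', hle⟩ := exists_tail_le_of_mem_tail hF ((mem_tail hF).2 (hFA 0))
  refine ⟨F', hF', hB'.trans inter_subset_left, x, hU.tendsto_right_iff.2 fun n _ => hle ?_⟩
  exact mem_of_superset ((mem_tail hF).2 (hFA n)) inter_subset_right

theorem IsPPlus.hFinBW [Countable Λ] (hρ : ρ.IsPPlus) {X : Type w} [TopologicalSpace X]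
    (hX : PropertyStar X) : ρ.HFinBW X := by
  rw [hFinBW_iff]
  intro B hB f
  obtain ⟨hc, hf⟩ := hX (range f) (countable_range f)
  have := isCompact_iff_compactSpace.1 hc
  obtain ⟨F, hF, hFB, x, hx⟩ := hρ.bwOn hB
    fun a => (⟨f a, subset_closure (mem_range_self a)⟩ : closure (range f))
  exact ⟨F, hF, hFB, x, (continuous_subtype_val.tendsto x).comp hx⟩

end PartitionRegularFunction

/-! ### The first uncountable ordinal -/

namespace OmegaOne

instance : WellFoundedLT OmegaOne.{w} :=
  inferInstanceAs (WellFoundedLT (Ordinal.omega.{w} 1).ToType)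

theorem mk_eq : Cardinal.mk OmegaOne.{w} = Cardinal.aleph 1 := by
  rw [OmegaOne, Cardinal.mk_toType, Ordinal.card_omega]

instance : Uncountable OmegaOne.{w} := by
  rw [← Cardinal.aleph0_lt_mk_iff, mk_eq]
  exact Cardinal.aleph0_lt_aleph_one

theorem countable_Iio (a : OmegaOne.{w}) : (Iio a).Countable := by
  have h := Cardinal.mk_Iio_lt a (by
    rw [mk_eq, Cardinal.ord_aleph]
    exact (Ordinal.type_toType _).symm)
  rwa [mk_eq, ← Cardinal.succ_aleph0, Order.lt_succ_iff, Cardinal.le_aleph0_iff_set_countable] at h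

theorem countable_Iic (a : OmegaOne.{w}) : (Iic a).Countable := by
  rw [← Iio_insert]
  exact (countable_Iio a).insert a

theorem exists_forall_le {ι : Type*} [Countable ι] (f : ι → OmegaOne.{w}) : ∃ a, ∀ i, f i ≤ a := by
  by_contra! h
  refine not_countable_univ (α := OmegaOne.{w}) ((countable_iUnion fun i =>
    countable_Iic (f i)).mono fun a _ => ?_)
  obtain ⟨i, hi⟩ := h a
  exact mem_iUnion.2 ⟨i, hi.le⟩

theorem not_compactSpace : ¬ CompactSpace OmegaOne.{w} := by
  intro _
  obtain ⟨a, -, ha⟩ := (isCompact_univ (X := OmegaOne.{w})).exists_isGreatest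
    univ_nonempty
  refine not_countable_univ (α := OmegaOne.{w}) ((countable_Iic a).mono fun b hb => ha hb)

end OmegaOne

/-- The range is bounded, so there is a least `b` for which `Iic b` has positive preimage. The
countably many small preimages of `Iic c`, `c < b`, are avoided below that positive set, which gives
convergence to `b` from below. -/
theorem PartitionRegularFunction.IsPMinus.finBW_omegaOne {Ω : Type u} {Λ : Type v} [Countable Λ]
    {ρ : PartitionRegularFunction Ω Λ} (hρ : ρ.IsPMinus) : ρ.FinBW OmegaOne.{w} := by
  rw [isPMinus_iff] at hρ
  rw [finBW_iff]
  intro f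
  have hex : ∃ b, f ⁻¹' Iic b ∉ ρ.ideal := by
    obtain ⟨b, hb⟩ := OmegaOne.exists_forall_le f
    refine ⟨b, ?_⟩
    convert ρ.univ_notMem_ideal
    exact eq_univ_of_forall hb
  obtain ⟨b, hb, hmin⟩ := wellFounded_lt.has_min {b | f ⁻¹' Iic b ∉ ρ.ideal} hex
  have := (OmegaOne.countable_Iio b).to_subtype
  obtain ⟨F, hF, hFB, hC⟩ := (hρ _ hb).exists_of_countable (ι := Iio b)
    (C := fun c => f ⁻¹' Iic c.1) fun c => by
      by_contra hc
      exact hmin c hc c.2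
  refine ⟨F, hF, subset_univ _, b, tendsto_order.2 ⟨fun c hc => ?_, fun c hc => ?_⟩⟩
  · filter_upwards [hC ⟨c, hc⟩] with a ha
    exact not_le.1 ha
  · filter_upwards [toFun_mem_tail hF] with a ha
    exact (hFB ha).trans_lt hc

namespace PartitionRegularFunction

variable {Ω : Type u} {Λ : Type v} {ρ : PartitionRegularFunction Ω Λ}

open MrowkaSpace

/-! ### Tallness and sequentially compact spaces -/

theorem finBW_of_not_tall (h : ¬ ρ.Tall) {X : Type w} [TopologicalSpace X] [SeqCompactSpace X] :
    ρ.FinBW X := by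
  rw [finBW_iff]
  intro f
  simp only [Tall, not_forall, not_exists, not_and] at h
  obtain ⟨A, hA, hAB⟩ := h
  obtain ⟨x, φ, hφ, hx⟩ := SeqCompactSpace.tendsto_subseq fun n => f (hA.natEmbedding A n)
  have hinj : Function.Injective fun n => (hA.natEmbedding A (φ n) : Λ) :=
    Subtype.val_injective.comp ((hA.natEmbedding A).injective.comp hφ.injective)
  obtain ⟨F, hF, hFB⟩ := exists_subset_of_notMem (hAB _
    (range_subset_iff.2 fun n => (hA.natEmbedding A (φ n)).2) (infinite_range_of_injective hinj))
  -- Finitely many terms of the subsequence may miss `U`; by (S) every single element of ρ(E) is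
  -- left by the tail.
  obtain ⟨E, hE, hEF, hsupp⟩ := ρ.support' F hF
  refine ⟨E, hE, subset_univ _, x, fun U hU => ?_⟩
  rw [← Nat.cofinite_eq_atTop] at hx
  have hfin := (eventually_cofinite.1 (hx hU)).image fun n => (hA.natEmbedding A (φ n) : Λ)
  have hK : ∀ b ∈ ρ E, ∀ᶠ a in ρ.tail E, a ≠ b := fun b hb => by
    obtain ⟨K, hKf, hKb⟩ := hsupp b hb
    exact (mem_tail hE).2 ⟨K, hKf, fun a ha hab => hKb (hab ▸ ha)⟩
  change ∀ᶠ a in ρ.tail E, f a ∈ U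
  filter_upwards [toFun_mem_tail hE, (eventually_all_finite (hfin.inter_of_left (ρ E))).2
    fun b hb => hK b hb.2] with a ha ha'
  by_contra haU
  obtain ⟨n, rfl⟩ := hFB (ρ.monotone' E hE F hF hEF ha)
  exact ha' _ ⟨mem_image_of_mem _ haU, ha⟩ rfl

/-- The identity on the family of all infinite sets. -/
def infiniteSets (Λ : Type v) [Infinite Λ] : PartitionRegularFunction Λ Λ where
  family := {F | F.Infinite}
  toFun := id
  family_nonempty := ⟨univ, infinite_univ⟩
  infinite_of_mem _ h := h
  diff_mem _ hF _ hK := hF.sdiff hK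
  infinite_toFun _ h := h
  monotone' _ _ _ _ h := h
  regular' F hF A B h := by
    rcases infinite_union.1 (show (A ∪ B).Infinite from h ▸ hF) with hA | hB
    exacts [⟨A, hA, Or.inl subset_rfl⟩, ⟨B, hB, Or.inr subset_rfl⟩]
  support' F hF := ⟨F, hF, subset_rfl, fun a _ => ⟨{a}, finite_singleton a, fun h => h.2 rfl⟩⟩

theorem mem_ideal_infiniteSets [Infinite Λ] {B : Set Λ} :
    B ∈ (infiniteSets Λ).ideal ↔ B.Finite :=
  ⟨fun h => not_infinite.1 fun hB => h B hB subset_rfl, fun h => mem_ideal_of_finite _ h⟩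

/-- This makes `bwOn_mrowkaSpace` applicable to ordinary sequences: for this function, `BWOn` yields
sequential compactness. -/
theorem isPMinus_infiniteSets [Infinite Λ] : (infiniteSets Λ).IsPMinus :=
  (isPMinus_iff _).2 fun B hB C hC =>
    have hB' : B ∈ (infiniteSets Λ).family := fun h => hB (mem_ideal_infiniteSets.2 h)
    ⟨B, hB', subset_rfl, fun n => (mem_tail hB').2
      ⟨C n, mem_ideal_infiniteSets.1 (hC n), fun _ ha => ha.2⟩⟩

/-- The one-point compactification of the Mrówka space of a maximal almost disjoint family is
sequentially compact. -/
theorem seqCompactSpace_mrowkaSpace {N I : Type w} [Countable N] [Infinite N] {A : I → Set N}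
    (hA : ∀ i j, i ≠ j → (A i ∩ A j).Finite)
    (hmax : ∀ S : Set N, S.Infinite → ∃ i, (A i ∩ S).Infinite) :
    SeqCompactSpace (MrowkaSpace A) := by
  refine (bwOn_mrowkaSpace (isPMinus_infiniteSets (Λ := N)) hA
    fun f hf hc hp => ?_).seqCompactSpace
  simp only [mem_ideal_infiniteSets] at hf hc hp
  -- The remaining case is void: with finite fibres, `f` hits infinitely many isolated points, so
  -- some `A i` contains infinitely many of them, yet its cell has finite preimage.
  obtain ⟨i, hi⟩ := hmax (point (A := A) ⁻¹' range f) fun hfin => hp <| by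
    have h := (hfin.image (point (A := A))).preimage' (f := f) fun x _ => hf x
    refine h.subset fun a ⟨n, hn⟩ => ⟨n, ⟨a, hn.symm⟩, hn⟩
  refine absurd ?_ hi
  refine Finite.subset (((hc i).image f).preimage point_injective.injOn) ?_
  rintro n ⟨hn, a, ha⟩
  exact ⟨a, by simpa [ha] using hn, ha⟩

/-- Zorn's lemma gives maximality only among families of small sets. Tallness removes this
restriction: an infinite set almost disjoint from the family would contain an infinite small set,
which could be added. -/
theorem Tall.exists_maximal_family {N : Type w} (h : ρ.Tall) (e : Λ ≃ N) :
    ∃ 𝒜 : Set (Set N), (∀ A ∈ 𝒜, e ⁻¹' A ∈ ρ.ideal) ∧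
      𝒜.Pairwise (fun A B => (A ∩ B).Finite) ∧
      ∀ S : Set N, S.Infinite → ∃ A ∈ 𝒜, (A ∩ S).Infinite := by
  obtain ⟨𝒜, hmax⟩ := zorn_subset {𝒜 : Set (Set N) | (∀ A ∈ 𝒜, e ⁻¹' A ∈ ρ.ideal) ∧
      𝒜.Pairwise (fun A B => (A ∩ B).Finite)} (fun c hc hchain => by
    refine ⟨⋃₀ c, ⟨?_, ?_⟩, fun s hs => subset_sUnion_of_mem hs⟩
    · rintro A ⟨s, hs, hA⟩
      exact (hc hs).1 A hA
    · exact (pairwise_sUnion hchain.directedOn).2 fun s hs => (hc hs).2)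
  refine ⟨𝒜, hmax.prop.1, hmax.prop.2, fun S hS => ?_⟩
  by_contra! hcon
  obtain ⟨T, hTS, hT, hTI⟩ := h (e ⁻¹' S) (hS.preimage (by simp))
  have hTS' : e '' T ⊆ S := image_subset_iff.2 hTS
  have hmem : e '' T ∈ 𝒜 := by
    refine hmax.mem_of_prop_insert ⟨?_, ?_⟩
    · rintro A (rfl | hA)
      · rwa [preimage_image_eq _ e.injective]
      · exact hmax.prop.1 A hA
    · refine hmax.prop.2.insert fun A hA _ => ⟨?_, ?_⟩
      · rw [inter_comm]
        exact (hcon A hA).subset (inter_subset_inter_right A hTS')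
      · exact (hcon A hA).subset (inter_subset_inter_right A hTS')
  have hfin := hcon _ hmem
  rw [inter_eq_left.2 hTS'] at hfin
  exact hT.image e.injective.injOn hfin

/-- For the embedding of Λ as the isolated points, a limit in `N` would put a finite set into the
tail filter, and the limit of a cell would put a small set there. A limit at infinity would yield an
infinite set almost disjoint from the whole family. -/
theorem Tall.exists_seqCompactSpace_not_finBW [Countable Ω] [Countable Λ] [Infinite Λ]
    (h : ρ.Tall) : ∃ (X : Type w) (_ : TopologicalSpace X), T2Space X ∧ SeqCompactSpace X ∧
      ¬ ρ.FinBW X := by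
  obtain ⟨e⟩ := nonempty_equiv_of_countable (α := Λ) (β := ULift.{w} ℕ)
  obtain ⟨e'⟩ := nonempty_equiv_of_countable (α := Λ) (β := ℕ)
  obtain ⟨𝒜, hI, had, hmad⟩ := h.exists_maximal_family e
  refine ⟨MrowkaSpace (fun A : 𝒜 => A.1), inferInstance, inferInstance,
    seqCompactSpace_mrowkaSpace
      (fun A B hAB => had A.2 B.2 (Subtype.val_injective.ne hAB)) (fun S hS => ?_), ?_⟩
  · obtain ⟨A, hA, hAS⟩ := hmad S hS
    exact ⟨⟨A, hA⟩, hAS⟩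
  · rw [finBW_iff]
    intro hX
    obtain ⟨F, hF, -, x, hx⟩ := hX fun a => point (e a)
    rcases eq_cases x with ⟨n, rfl⟩ | ⟨A, rfl⟩ | rfl
    · have := (MrowkaSpace.tendsto_nhds.1 hx).1 n
      simp only [point_inj, iff_true] at this
      exact infinite_of_mem_tail hF this ((finite_singleton n).preimage e.injective.injOn)
    · have := (MrowkaSpace.tendsto_nhds.1 hx).2 A
      simp only [point_mem_cell, limit_mem_cell, iff_true] at this
      exact notMem_ideal_of_mem_tail hF this (hI A A.2)
    · obtain ⟨φ, hφ, hφt⟩ := exists_strictMono_tendsto_tail e' hF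
      have hinj : Function.Injective fun n => e (e'.symm (φ n)) :=
        e.injective.comp (e'.symm.injective.comp hφ.injective)
      obtain ⟨A, hA, hAi⟩ := hmad _ (infinite_range_of_injective hinj)
      have hev := hφt ((tendsto_infty.1 hx).2 ⟨A, hA⟩)
      simp only [point_mem_cell, ← Nat.cofinite_eq_atTop] at hev
      refine hAi (Finite.subset ((eventually_cofinite.1 hev).image
        fun n => e (e'.symm (φ n))) ?_)
      rintro _ ⟨hn, n, rfl⟩
      exact ⟨n, fun hc => hc hn, rfl⟩

end PartitionRegularFunction

/-! ### A separable space under the continuum hypothesis -/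

/-- Transfinite recursion for a choice whose possibility depends on the previous choices. -/
theorem WellFoundedLT.exists_rec {I D : Type*} [LinearOrder I] [WellFoundedLT I] [Nonempty D]
    (P : ∀ i : I, (Iio i → D) → D → Prop)
    (h : ∀ (i : I) (p : I → D), (∀ j < i, P j (fun k => p k) (p j)) →
      ∃ d, P i (fun k => p k) d) :
    ∃ p : I → D, ∀ i, P i (fun k => p k) (p i) := by
  classical
  let step : ∀ i : I, (∀ j, j < i → D) → D := fun i r =>
    -- The arbitrary value is never used: by induction a suitable choice exists at every stage.
    if hd : ∃ d, P i (fun k => r k k.2) d then hd.choose else Classical.arbitrary D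
  let p : I → D := wellFounded_lt.fix step
  refine ⟨p, fun i => ?_⟩
  induction i using WellFoundedLT.induction with
  | ind i ih =>
    have hd := h i p ih
    have hp : p i = hd.choose := by
      rw [show p i = step i fun j _ => p j from wellFounded_lt.fix_eq step i]
      exact dif_pos hd
    rw [hp]
    exact hd.choose_spec

/-- If finitely many members of a countable family never cover all but finitely many elements,
then some infinite set is almost disjoint from all members of the family. -/
theorem exists_infinite_almost_disjoint {N : Type*} [Countable N] [Infinite N] {ι : Type*}
    [Countable ι] {b : ι → Set N} (hb : ∀ s : Finset ι, (⋃ j ∈ s, b j)ᶜ.Infinite) :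
    ∃ Z : Set N, Z.Infinite ∧ ∀ j, (Z ∩ b j).Finite := by
  obtain ⟨e⟩ := nonempty_equiv_of_countable (α := N) (β := ℕ)
  obtain ⟨i, hi⟩ := exists_injective_nat ι
  have hfin : ∀ n, (i ⁻¹' Iic n).Finite := fun n => (finite_Iic n).preimage hi.injOn
  obtain ⟨φ, hφ, h⟩ := Filter.extraction_forall_of_frequently
    (P := fun n k => e.symm k ∈ (⋃ j ∈ i ⁻¹' Iic n, b j)ᶜ) (fun n => by
      rw [Nat.frequently_atTop_iff_infinite]
      have := hb (hfin n).toFinset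
      simp only [Finite.mem_toFinset] at this
      exact this.preimage (by simp))
  refine ⟨range fun n => e.symm (φ n), infinite_range_of_injective
    (e.symm.injective.comp hφ.injective), fun j => ?_⟩
  -- The n-th term avoids all sets of index at most `n`, so only terms with `n < i j` can lie in `b
  -- j`.
  refine ((finite_Iio (i j)).image fun n => e.symm (φ n)).subset ?_
  rintro _ ⟨⟨n, rfl⟩, hn⟩
  refine ⟨n, ?_, rfl⟩
  by_contra hij
  exact h n (mem_biUnion (show i j ≤ n from not_lt.1 hij) hn)

theorem Set.Infinite.exists_infinite_split {N : Type*} {Z : Set N} (hZ : Z.Infinite) :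
    ∃ Z₀ Z₁ : Set N, Z₀.Infinite ∧ Z₁.Infinite ∧ Disjoint Z₀ Z₁ ∧ Z₀ ∪ Z₁ ⊆ Z := by
  have hinj : Function.Injective fun n => (hZ.natEmbedding Z n : N) :=
    Subtype.val_injective.comp (hZ.natEmbedding Z).injective
  refine ⟨range fun n => (hZ.natEmbedding Z (2 * n) : N),
    range fun n => (hZ.natEmbedding Z (2 * n + 1) : N), infinite_range_of_injective
      fun m n h => ?_, infinite_range_of_injective fun m n h => ?_, ?_, ?_⟩
  · have := hinj h
    omega
  · have := hinj h
    omega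
  · rw [disjoint_left]
    rintro _ ⟨m, rfl⟩ ⟨n, h⟩
    have := hinj h
    omega
  · rintro _ (⟨m, rfl⟩ | ⟨m, rfl⟩)
    exacts [Subtype.coe_prop _, Subtype.coe_prop _]

/-! ### Almost disjoint families adapted to all functions -/

namespace PartitionRegularFunction

variable {Ω : Type u} {Λ : Type v} {ρ : PartitionRegularFunction Ω Λ}

open MrowkaSpace

/-- A set `A` which is almost disjoint from all `b j`, and a set `b ⊇ A` such that the partial
function `g` from `Λ` to `N` is taken care of: it is positive on `A` or on some `a j`, or else it
is almost disjoint from all `a j` on the tails of some `F` with `g[ρ(F)] ⊆ b \ A`. -/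
structure IsExtension (ρ : PartitionRegularFunction Ω Λ) {N : Type w} (g : Λ → Option N)
    {ι : Type w} (a b : ι → Set N) (A b' : Set N) : Prop where
  infinite : A.Infinite
  subset : A ⊆ b'
  finite_inter : ∀ j, (A ∩ b j).Finite
  infinite_compl : ∀ s : Finset ι, ((⋃ j ∈ s, b j) ∪ b')ᶜ.Infinite
  alternative : (∀ n, g ⁻¹' {some n} ∈ ρ.ideal) → g ⁻¹' range some ∉ ρ.ideal →
    (∀ j, g ⁻¹' (some '' a j) ∈ ρ.ideal) → g ⁻¹' (some '' A) ∈ ρ.ideal →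
    ∃ F ∈ ρ.family, ρ F ⊆ g ⁻¹' (some '' (b' \ A)) ∧ (∀ n, ∀ᶠ c in ρ.tail F, g c ≠ some n) ∧
      ∀ j, ∀ᶠ c in ρ.tail F, g c ∉ some '' a j

/-- Split an infinite set almost disjoint from all `b j` into two halves. If one half has positive
preimage, it serves as both `A` and `b'`, and the last condition is void. If both preimages are
small, the rest of `N` still carries a positive set, and P⁻ applies there. The half left out of `b'`
keeps the complements infinite. -/
theorem IsPMinus.exists_isExtension (hρ : ρ.IsPMinus) {N : Type w} [Countable N] [Infinite N]
    (g : Λ → Option N) {ι : Type w} [Countable ι] (a b : ι → Set N)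
    (hb : ∀ s : Finset ι, (⋃ j ∈ s, b j)ᶜ.Infinite) :
    ∃ A b', ρ.IsExtension g a b A b' := by
  rw [isPMinus_iff] at hρ
  obtain ⟨Z, hZ, hZb⟩ := exists_infinite_almost_disjoint hb
  obtain ⟨Z₀, Z₁, hZ₀, hZ₁, hd, hsub⟩ := hZ.exists_infinite_split
  have hsub₀ := subset_union_left.trans hsub
  have hsub₁ := subset_union_right.trans hsub
  have compl : ∀ W b' : Set N, W.Infinite → W ⊆ Z → Disjoint b' W →
      ∀ s : Finset ι, ((⋃ j ∈ s, b j) ∪ b')ᶜ.Infinite := by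
    intro W b' hW hWZ hb'W s
    have hf : (⋃ j ∈ s, Z ∩ b j).Finite := s.finite_toSet.biUnion fun j _ => hZb j
    refine (hW.sdiff hf).mono ?_
    rintro n ⟨hnW, hn⟩ (hn' | hn')
    · simp only [mem_iUnion, mem_inter_iff, not_exists] at hn hn'
      obtain ⟨j, hj, hjn⟩ := hn'
      exact hn j hj ⟨hWZ hnW, hjn⟩
    · exact hb'W.le_bot ⟨hn', hnW⟩
  have fin : ∀ W ⊆ Z, ∀ j, (W ∩ b j).Finite :=
    fun W hW j => (hZb j).subset (inter_subset_inter_left _ hW)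
  by_cases h₀ : g ⁻¹' (some '' Z₀) ∈ ρ.ideal
  · by_cases h₁ : g ⁻¹' (some '' Z₁) ∈ ρ.ideal
    · refine ⟨Z₀, Z₁ᶜ, hZ₀, hd.subset_compl_right, fin Z₀ hsub₀,
        compl Z₁ _ hZ₁ hsub₁ disjoint_compl_left, fun hn hr ha _ => ?_⟩
      have hpos : g ⁻¹' (some '' (Z₁ᶜ \ Z₀)) ∉ ρ.ideal := fun hI => by
        refine hr (ideal_mono ?_ (union_mem_ideal (union_mem_ideal h₀ h₁) hI))
        rintro c ⟨n, hn⟩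
        simp only [mem_union, mem_preimage, ← hn, (Option.some_injective N).mem_set_image,
          Set.mem_sdiff, mem_compl_iff]
        tauto
      obtain ⟨F, hF, hFB, hC⟩ := (hρ _ hpos).exists_of_countable
        (C := Sum.elim (fun n => g ⁻¹' {some n}) fun j => g ⁻¹' (some '' a j))
        (by rintro (n | j); exacts [hn n, ha j])
      exact ⟨F, hF, hFB, fun n => hC (Sum.inl n), fun j => hC (Sum.inr j)⟩
    · exact ⟨Z₁, Z₁, hZ₁, subset_rfl, fin Z₁ hsub₁, compl Z₀ _ hZ₀ hsub₀ hd.symm,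
        fun _ _ _ h => absurd h h₁⟩
  · exact ⟨Z₀, Z₀, hZ₀, subset_rfl, fin Z₀ hsub₀, compl Z₁ _ hZ₁ hsub₁ hd,
      fun _ _ _ h => absurd h h₀⟩

theorem IsPMinus.exists_extensions (hρ : ρ.IsPMinus) {N I : Type w} [Countable N] [Infinite N]
    [LinearOrder I] [WellFoundedLT I] (hI : ∀ i : I, (Iio i).Countable) (g : I → Λ → Option N) :
    ∃ A b : I → Set N, ∀ i, ρ.IsExtension (g i) (fun j : Iio i => A j) (fun j : Iio i => b j)
      (A i) (b i) := by
  obtain ⟨p, hp⟩ := WellFoundedLT.exists_rec (D := Set N × Set N)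
    (fun (i : I) q d => ρ.IsExtension (g i) (fun j => (q j).1) (fun j => (q j).2) d.1 d.2)
    (fun i p hp => by
      have := (hI i).to_subtype
      have hs : ∀ s : Finset (Iio i), (⋃ j ∈ s, (p j).2)ᶜ.Infinite := by
        intro s
        rcases s.eq_empty_or_nonempty with rfl | hs
        · simpa using infinite_univ
        -- The largest index `m` in `s` suffices: the stage `m` already guarantees that finitely
        -- many earlier sets together with `b m` have infinite complement.
        · have hm := s.le_max'
          set m := s.max' hs
          have hinj : Function.Injective fun j : Iio m.1 => (⟨j, j.2.trans m.2⟩ : Iio i) :=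
            fun j k hjk => Subtype.ext (congrArg (fun x : Iio i => x.1) hjk)
          refine ((hp m m.2).infinite_compl (s.preimage _ hinj.injOn)).mono
            (compl_subset_compl.2 (iUnion₂_subset fun j hj => ?_))
          rcases (hm j hj).lt_or_eq with hjm | hjm
          · exact subset_union_of_subset_left (subset_biUnion_of_mem (x := ⟨j.1, hjm⟩)
              (u := fun k : Iio m.1 => (p k).2) (Finset.mem_preimage.2 hj)) _
          · rw [hjm]
            exact subset_union_right
      obtain ⟨A, b, h⟩ := hρ.exists_isExtension (g i) (fun j : Iio i => (p j).1)
        (fun j : Iio i => (p j).2) hs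
      exact ⟨(A, b), h⟩)
  exact ⟨fun i => (p i).1, fun i => (p i).2, hp⟩

/-- By CH all partial functions from Λ to `N` are listed in type ω₁, so every `f` is treated at some
stage `i`. The resulting `F` avoids the earlier `A k` by P⁻, `A i` because values lie in `b i \ A
i`, and the later `A k` because they meet `b i` in a finite set. -/
theorem IsPMinus.exists_separable_finBW [Countable Λ] [Infinite Λ] (hρ : ρ.IsPMinus)
    (hCH : Cardinal.continuum.{w} = Cardinal.aleph 1) :
    ∃ (X : Type w) (_ : TopologicalSpace X), T2Space X ∧ CompactSpace X ∧
      TopologicalSpace.SeparableSpace X ∧ Cardinal.mk X = Cardinal.continuum ∧ ρ.FinBW X := by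
  obtain ⟨g, hg⟩ : ∃ g : OmegaOne.{w} → Λ → Option (ULift.{w} ℕ), Function.Surjective g := by
    obtain ⟨e⟩ := nonempty_equiv_of_countable (α := Λ) (β := ULift.{w} ℕ)
    have hc : Cardinal.mk OmegaOne.{w} =
        Cardinal.mk (ULift.{w} ℕ → Option (ULift.{w} ℕ)) := by
      rw [OmegaOne.mk_eq, ← hCH]
      simp
    obtain ⟨φ⟩ := Cardinal.eq.1 hc
    exact ⟨_, (φ.trans (e.arrowCongr (Equiv.refl (Option (ULift.{w} ℕ)))).symm).surjective⟩
  obtain ⟨A, b, h⟩ := hρ.exists_extensions OmegaOne.countable_Iio g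
  have hAb : ∀ i j, i < j → (A j ∩ b i).Finite := fun i j hij => (h j).finite_inter ⟨i, hij⟩
  have hA : ∀ i j, i ≠ j → (A i ∩ A j).Finite := fun i j hij => by
    rcases hij.lt_or_gt with hij | hij
    · rw [inter_comm]
      exact (hAb i j hij).subset (inter_subset_inter_right _ (h i).subset)
    · exact (hAb j i hij).subset (inter_subset_inter_right _ (h j).subset)
  refine ⟨MrowkaSpace A, inferInstance, inferInstance, compactSpace hA,
    separableSpace hA fun i => (h i).infinite, ?_, ?_⟩
  · rw [mk_eq, OmegaOne.mk_eq, ← hCH]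
    simp [Cardinal.add_one_eq Cardinal.aleph0_le_continuum]
  · rw [finBW_iff]
    refine bwOn_mrowkaSpace hρ hA fun f hf hc hp => ?_
    obtain ⟨i, hi⟩ := hg fun c => toOption (f c)
    have hgf : ∀ {c n}, g i c = some n ↔ f c = point n := by
      intro c n
      rw [hi, toOption_eq_some]
    have hgfs : ∀ {c} {s : Set (ULift.{w} ℕ)}, g i c ∈ some '' s ↔ f c ∈ point '' s := by
      intro c s
      simp only [mem_image, eq_comm (b := g i c), eq_comm (b := f c), hgf]
    have hgA : ∀ j, g i ⁻¹' (some '' A j) ∈ ρ.ideal := fun j =>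
      ideal_mono (fun c hcj => Or.inr (hgfs.1 hcj)) (hc j)
    obtain ⟨F, hF, hFb, hn, hj⟩ := (h i).alternative
      (fun n => ideal_mono (fun c hcn => hgf.1 hcn) (hf (point n)))
      (by
        rw [← image_univ] at hp ⊢
        exact fun hI => hp (ideal_mono (fun c hcn => hgfs.2 hcn) hI))
      (fun j => hgA j) (hgA i)
    have hx : ∀ x, ∀ᶠ c in ρ.tail F, f c ≠ x := by
      intro x
      rcases eq_cases x with ⟨n, rfl⟩ | ⟨k, rfl⟩ | rfl
      · filter_upwards [hn n] with c hc' hcx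
        exact hc' (hgf.2 hcx)
      -- All values of `f` on ρ(F) are isolated points.
      all_goals
        filter_upwards [toFun_mem_tail hF] with c hc' hcx
        obtain ⟨m, -, hm⟩ := hgfs.1 (hFb hc')
        exact absurd (hm.trans hcx) (by simp [eq_comm])
    refine ⟨F, hF, hx, fun k => ?_⟩
    have hpt : ∀ᶠ c in ρ.tail F, f c ∉ point '' A k := by
      rcases lt_trichotomy k i with hk | rfl | hk
      · filter_upwards [hj ⟨k, hk⟩] with c hc' hcx
        exact hc' (hgfs.2 hcx)
      · filter_upwards [toFun_mem_tail hF] with c hc'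
        rintro ⟨m, hm, hmc⟩
        obtain ⟨m', hm', hmc'⟩ := hgfs.1 (hFb hc')
        exact hm'.2 (point_injective (hmc'.trans hmc.symm) ▸ hm)
      · filter_upwards [toFun_mem_tail hF, (eventually_all_finite (hAb i k hk)).2
          fun m _ => hx (point m)] with c hc' hcx
        rintro ⟨m, hm, hmc⟩
        obtain ⟨m', hm', hmc'⟩ := hgfs.1 (hFb hc')
        have := point_injective (hmc'.trans hmc.symm)
        exact hcx m ⟨hm, this ▸ hm'.1⟩ hmc.symm
    filter_upwards [hpt, hx (limit k)] with c h1 h2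
    rintro (h' | h')
    exacts [h2 h', h1 h']

end PartitionRegularFunction

/-! ### The main theorem -/

theorem mainTheorem6 {Ω : Type u} {Λ : Type v} [Countable Ω] [Infinite Ω] [Countable Λ]
    [Infinite Λ] (ρ : PartitionRegularFunction Ω Λ) :
    -- all finite spaces are in `FinBW(ρ)`, and all spaces in `FinBW(ρ)` are sequentially compact
    ((∀ (X : Type w) [TopologicalSpace X] [Finite X], ρ.FinBW X) ∧
      (∀ (X : Type w) [TopologicalSpace X], ρ.FinBW X → SeqCompactSpace X)) ∧
    -- `ρ` is not tall iff `FinBW(ρ)` is the class of all sequentially compact spaces,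
    -- both among all topological spaces and among Hausdorff spaces
    ((¬ ρ.Tall ↔ ∀ (X : Type w) [TopologicalSpace X], ρ.FinBW X ↔ SeqCompactSpace X) ∧
      (¬ ρ.Tall ↔
        ∀ (X : Type w) [TopologicalSpace X] [T2Space X], ρ.FinBW X ↔ SeqCompactSpace X)) ∧
    -- characterizations of `P⁻(Λ)`
    [ρ.IsPMinusWhole,
      ∀ κ : Cardinal.{w}, ∃ (X : Type w) (_ : TopologicalSpace X),
        T2Space X ∧ CompactSpace X ∧ Cardinal.mk X = κ ∧ ρ.FinBW X,
      ∃ (X : Type w) (_ : TopologicalSpace X), Infinite X ∧ T2Space X ∧ ρ.FinBW X].TFAE ∧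
    -- characterizations of `P⁻`
    [ρ.IsPMinus,
      ∀ κ : Cardinal.{w}, ∃ (X : Type w) (_ : TopologicalSpace X),
        T2Space X ∧ CompactSpace X ∧ Cardinal.mk X = κ ∧ ρ.HFinBW X,
      ∃ (X : Type w) (_ : TopologicalSpace X), Infinite X ∧ T2Space X ∧ ρ.HFinBW X].TFAE ∧
    -- consequences of `P⁻`
    (ρ.IsPMinus →
      (Uncountable OmegaOne.{w} ∧ ¬ CompactSpace OmegaOne.{w} ∧ T2Space OmegaOne.{w} ∧
        ρ.FinBW OmegaOne.{w}) ∧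
      (Cardinal.continuum.{w} = Cardinal.aleph.{w} 1 →
        ∃ (X : Type w) (_ : TopologicalSpace X), T2Space X ∧ CompactSpace X ∧
          TopologicalSpace.SeparableSpace X ∧ Cardinal.mk X = Cardinal.continuum.{w} ∧
          ρ.FinBW X)) ∧
    -- consequence of weak `P⁺`
    (ρ.IsWeakPPlus → ∀ (X : Type w) [MetricSpace X] [CompactSpace X], ρ.HFinBW X) ∧
    -- consequence of `P⁺`
    (ρ.IsPPlus →
      ∀ (X : Type w) [TopologicalSpace X] [T2Space X], PropertyStar X → ρ.HFinBW X) := by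
  have whole_to_card : ρ.IsPMinusWhole → ∀ κ : Cardinal.{w},
      ∃ (X : Type w) (_ : TopologicalSpace X),
        T2Space X ∧ CompactSpace X ∧ Cardinal.mk X = κ ∧ ρ.FinBW X := by
    intro h κ
    obtain ⟨X, _, hX, hc, hκ, hB⟩ := ρ.exists_compact_bwOn κ
    exact ⟨X, _, hX, hc, hκ, ρ.finBW_iff.2 (hB _ ρ.univ_notMem_ideal (ρ.isPMinusWhole_iff.1 h))⟩
  have minus_to_card : ρ.IsPMinus → ∀ κ : Cardinal.{w},
      ∃ (X : Type w) (_ : TopologicalSpace X),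
        T2Space X ∧ CompactSpace X ∧ Cardinal.mk X = κ ∧ ρ.HFinBW X := by
    intro h κ
    obtain ⟨X, _, hX, hc, hκ, hB⟩ := ρ.exists_compact_bwOn κ
    exact ⟨X, _, hX, hc, hκ, ρ.hFinBW_iff.2 fun B hBI => hB B hBI (ρ.isPMinus_iff.1 h B hBI)⟩
  have seqCompact : ∀ (X : Type w) [TopologicalSpace X], ρ.FinBW X → SeqCompactSpace X :=
    fun X _ h => (ρ.finBW_iff.1 h).seqCompactSpace
  have infinite_of_mk : ∀ X : Type w, Cardinal.mk X = Cardinal.aleph0 → Infinite X :=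
    fun X h => Cardinal.infinite_iff.2 h.ge
  refine ⟨⟨fun X _ _ => ρ.finBW_iff.2 (ρ.bwOn_of_finite ρ.univ_notMem_ideal X), seqCompact⟩,
    ⟨⟨fun h X _ => ⟨seqCompact X, fun _ => ρ.finBW_of_not_tall h⟩, fun h ht => ?_⟩,
      ⟨fun h X _ _ => ⟨seqCompact X, fun _ => ρ.finBW_of_not_tall h⟩, fun h ht => ?_⟩⟩,
    ?_, ?_, fun h => ⟨⟨inferInstance, OmegaOne.not_compactSpace, inferInstance,
      h.finBW_omegaOne⟩, fun hCH => h.exists_separable_finBW hCH⟩,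
    fun h X _ _ => h.hFinBW X, fun h X _ _ hX => h.hFinBW hX⟩
  · obtain ⟨X, _, _, hX, hn⟩ := ht.exists_seqCompactSpace_not_finBW
    exact hn ((h X).2 hX)
  · obtain ⟨X, _, _, hX, hn⟩ := ht.exists_seqCompactSpace_not_finBW
    exact hn ((h X).2 hX)
  · tfae_have 1 → 2 := whole_to_card
    tfae_have 2 → 3 := fun h => by
      obtain ⟨X, hX, hT, -, hκ, hB⟩ := h Cardinal.aleph0
      exact ⟨X, hX, infinite_of_mk X hκ, hT, hB⟩
    tfae_have 3 → 1 := by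
      rintro ⟨X, _, _, _, hB⟩
      exact ρ.isPMinusWhole_iff.2 (ρ.finBW_iff.1 hB).diagOn
    tfae_finish
  · tfae_have 1 → 2 := minus_to_card
    tfae_have 2 → 3 := fun h => by
      obtain ⟨X, hX, hT, -, hκ, hB⟩ := h Cardinal.aleph0
      exact ⟨X, hX, infinite_of_mk X hκ, hT, hB⟩
    tfae_have 3 → 1 := by
      rintro ⟨X, _, _, _, hB⟩
      exact ρ.isPMinus_iff.2 fun B hBI => (ρ.hFinBW_iff.1 hB B hBI).diagOn
    tfae_finish
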